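/- Let $p$ be an odd prime. For each $n\ge 0$ let the Steenrod algebra $\mathcal A_p$ of $p$-th powers (no Bocksteins) act on $\mathbb F_p[x_1,\dots,x_n]$ as usual: each $P^r$ is linear, and $f\mapsto\sum_{r\ge 0}(P^rf)\,s^r$ is the algebra homomorphism with $x_j\mapsto x_j+x_j^p\,s$. For a finite sequence $R=(r_1,r_2,\dots)$ of non-negative integers (almost all $0$) let $P(R)\in\mathcal A_p$ be the Milnor basis element, i.e. the element dual to the monomial $\xi_1^{r_1}\xi_2^{r_2}\cdots$ in Milnor's generators of the dual algebra; its action on a polynomial $f$ is the coefficient of $\xi_1^{r_1}\xi_2^{r_2}\cdots$ in the image of $f$ under the algebra homomorphism with $x_j\mapsto x_j+\sum_{k\ge1}x_j^{p^k}\xi_k$. For exponents $s_1,\dots,s_n$ write $[x_1^{s_1},\dots,x_n^{s_n}]=\det\bigl(x_j^{s_i}\bigr)_{1\le i,j\le n}$. Let $m\ge 0$, let $b_1,\dots,b_m$ be pairwise distinct positive integers, and let $R=(r_1,r_2,\dots)$ with $r_i=p-1$ if $i\in\{b_1,\dots,b_m\}$ and $r_i=0$ otherwise. Then $$P(R)\,(x_1\cdots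 x_n)^{p-1}=\begin{cases}[x_1^{p^{b_1}},\dots,x_n^{p^{b_n}}]^{p-1} & \text{if } m=n,\\[2pt] [x_1,x_2^{p^{b_1}},\dots,x_n^{p^{b_{n-1}}}]^{p-1} & \text{if } m=n-1.\end{cases}$$ -/

import Mathlib

open MvPolynomial

/-- The polynomial algebra `𝔽_p[x_1, …, x_n]`; the variable `x_{j+1}` is `X j`. -/
abbrev PolyAlg (p n : ℕ) : Type := MvPolynomial (Fin n) (ZMod p)

/-- The total Steenrod power `f ↦ ∑_r (P^r f) s^r`: the algebra homomorphism
with `x_j ↦ x_j + x_j^p s`. -/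
noncomputable def totalPower (p n : ℕ) : PolyAlg p n →ₐ[ZMod p] Polynomial (PolyAlg p n) :=
  aeval fun j => Polynomial.C (X j) + Polynomial.X * Polynomial.C (X j ^ p)

/-- The Steenrod `p`-th power `P^r`, as a natural operation on the polynomial algebras in any
finite number `n` of variables. -/
noncomputable def steenrodPower (p r : ℕ) : ∀ n : ℕ, Module.End (ZMod p) (PolyAlg p n) := fun n =>
  ((Polynomial.lcoeff (PolyAlg p n) r).restrictScalars (ZMod p)) ∘ₗ (totalPower p n).toLinearMap

/-- The algebra `𝒜_p` of Steenrod `p`-th powers (no Bocksteins), realised as the algebra of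
natural operations on polynomial algebras generated by all `P^r`. -/
noncomputable def steenrodAlgebra (p : ℕ) :
    Subalgebra (ZMod p) (∀ n : ℕ, Module.End (ZMod p) (PolyAlg p n)) :=
  Algebra.adjoin (ZMod p) (Set.range (steenrodPower p))

/-- The left action of `𝒜_p` on `𝔽_p[x_1, …, x_n]`. -/
noncomputable instance steenrodModule (p n : ℕ) : Module (steenrodAlgebra p) (PolyAlg p n) :=
  Module.compHom (PolyAlg p n)
    ((Pi.evalRingHom (fun n : ℕ => Module.End (ZMod p) (PolyAlg p n)) n).comp
      (steenrodAlgebra p).val.toRingHom)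

/-- The formal power series `x_j + ∑_{k ≥ 1} x_j^{p^k} ξ_k` in `ξ_1, ξ_2, …`, given by its
coefficients. -/
noncomputable def milnorSeries (p n : ℕ) (j : Fin n) : MvPowerSeries ℕ+ (PolyAlg p n) :=
  fun e : ℕ+ →₀ ℕ =>
    if e = 0 then X j
    else ∑ k ∈ e.support, if e = Finsupp.single k 1 then X j ^ p ^ (k : ℕ) else 0

/-- Milnor's coaction of the dual Hopf algebra `𝔽_p[ξ_1, ξ_2, …]` of `𝒜_p` on `𝔽_p[x_1, …, x_n]`:
the algebra homomorphism with `x_j ↦ x_j + ∑_{k ≥ 1} x_j^{p^k} ξ_k`. -/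
noncomputable def milnorCoaction (p n : ℕ) :
    PolyAlg p n →ₐ[ZMod p] MvPowerSeries ℕ+ (PolyAlg p n) :=
  aeval (milnorSeries p n)

/-- The operation dual to the monomial `ξ^R = ξ_1^{r_1} ξ_2^{r_2} ⋯`: it sends `f` to the
coefficient of `ξ^R` in the coaction on `f`. -/
noncomputable def milnorOperation (p : ℕ) (R : ℕ+ →₀ ℕ) :
    ∀ n : ℕ, Module.End (ZMod p) (PolyAlg p n) := fun n =>
  ((MvPowerSeries.coeff (R := PolyAlg p n) R).restrictScalars (ZMod p)) ∘ₗ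
    (milnorCoaction p n).toLinearMap

/-! The rest of the development up to `milnorOperation_mem` shows that the operation dual to
`ξ^R` lies in `𝒜_p`. -/

namespace MilnorAux

variable {p : ℕ}

/-- `ξ_i`, with `ξ_0 = 1`. -/
noncomputable def tau (B : Type*) [CommRing B] : ℕ → MvPolynomial ℕ+ B
  | 0 => 1
  | i + 1 => X i.succPNat

/-- The coaction with `ξ_i = 0` for `i > k`. -/
noncomputable def lam (p n k : ℕ) : PolyAlg p n →ₐ[ZMod p] MvPolynomial ℕ+ (PolyAlg p n) :=
  aeval fun j => ∑ i ∈ Finset.range (k + 1), tau (PolyAlg p n) i * C (X j ^ p ^ i)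

/-- The substitution that computes the composite of the coaction and the total power. -/
noncomputable def psi (p : ℕ) (B : Type*) [CommRing B] (K : ℕ) :
    MvPolynomial ℕ+ B →ₐ[B] Polynomial (MvPolynomial ℕ+ B) :=
  aeval fun i => (if (i : ℕ) ≤ K then Polynomial.C (X i) else 0) +
    (if (i : ℕ) ≤ K + 1 then Polynomial.X * Polynomial.C (tau B ((i : ℕ) - 1) ^ p) else 0)

theorem lam_coeff (n k : ℕ) (f : PolyAlg p n) (R : ℕ+ →₀ ℕ) (hR : ∀ i ∈ R.support, (i : ℕ) ≤ k) :
    MvPowerSeries.coeff R (milnorCoaction p n f) = coeff R (lam p n k f) := by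
  classical
  induction f using MvPolynomial.induction_on generalizing R with
  | C a =>
    have h1 : milnorCoaction p n (C a) = MvPowerSeries.C (C a) := by
      rw [← algebraMap_eq, AlgHom.commutes, MvPowerSeries.algebraMap_apply]
    have h2 : lam p n k (C a) = C (C a) := by
      rw [← algebraMap_eq, AlgHom.commutes]; rfl
    rw [h1, h2, MvPowerSeries.coeff_C, coeff_C]
    simp [eq_comm]
  | add f g hf hg => simp only [map_add, coeff_add, hf R hR, hg R hR]
  | mul_X f j hf =>
    rw [map_mul (milnorCoaction p n), map_mul (lam p n k), MvPowerSeries.coeff_mul, coeff_mul]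
    refine Finset.sum_congr rfl fun e he => ?_
    rw [Finset.HasAntidiagonal.mem_antidiagonal] at he
    have hs1 : ∀ i ∈ e.1.support, (i : ℕ) ≤ k := fun i hi => hR i (by
      simp only [Finsupp.mem_support_iff, ← he, Finsupp.add_apply] at hi ⊢; omega)
    have hs2 : ∀ i ∈ e.2.support, (i : ℕ) ≤ k := fun i hi => hR i (by
      simp only [Finsupp.mem_support_iff, ← he, Finsupp.add_apply] at hi ⊢; omega)
    rw [hf _ hs1]
    congr 1
    generalize e.2 = Q at hs2
    rw [lam, milnorCoaction, aeval_X, aeval_X, coeff_sum, Finset.sum_range_succ']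
    simp only [mul_comm _ (C _), coeff_C_mul, tau, coeff_one, coeff_X]
    change (if Q = 0 then X j
      else ∑ k ∈ Q.support, if Q = Finsupp.single k 1 then X j ^ p ^ (k : ℕ) else 0) = _
    by_cases hQ : Q = 0
    · subst hQ
      simp
    · rw [if_neg hQ, if_neg (Ne.symm hQ)]
      by_cases hq : ∃ q : ℕ+, Q = Finsupp.single q 1
      · obtain ⟨q, rfl⟩ := hq
        have hqk : (q : ℕ) ≤ k := hs2 q (by simp)
        rw [Finsupp.support_single _ one_ne_zero, Finset.sum_singleton, if_pos rfl,
          Finset.sum_eq_single ((q : ℕ) - 1)]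
        · have hq1 : (q : ℕ) - 1 + 1 = q := Nat.sub_add_cancel q.pos
          have : ((q : ℕ) - 1).succPNat = q := PNat.eq hq1
          simp [this, hq1]
        · intro i _ hi
          rw [if_neg, mul_zero]
          intro h
          have := Finsupp.single_left_injective (one_ne_zero) h
          apply hi
          rw [← this]; simp
        · intro h
          exact absurd (Finset.mem_range.2 (by have := q.pos; omega)) h
      · push Not at hq
        rw [Finset.sum_eq_zero (fun i _ => if_neg (hq i)), Finset.sum_eq_zero]
        · simp
        · intro i _
          rw [if_neg (fun h => hq _ h.symm), mul_zero]

theorem psi_lam [Fact p.Prime] (n K : ℕ) (f : PolyAlg p n) :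
    psi p (PolyAlg p n) K (lam p n (K + 1) f) =
      (totalPower p n f).map (lam p n K).toRingHom := by
  have key : ((psi p (PolyAlg p n) K).restrictScalars (ZMod p)).comp (lam p n (K + 1)) =
      (Polynomial.mapAlgHom (lam p n K)).comp (totalPower p n) := by
    refine MvPolynomial.algHom_ext fun j => ?_
    simp only [AlgHom.comp_apply, AlgHom.restrictScalars_apply, totalPower, aeval_X, map_add,
      map_mul]
    have hx : Polynomial.mapAlgHom (lam p n K) (Polynomial.C (X j)) =
        Polynomial.C (∑ i ∈ Finset.range (K + 1), tau (PolyAlg p n) i * C (X j ^ p ^ i)) := by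
      simp [Polynomial.coe_mapAlgHom, lam]
    have hxp : Polynomial.mapAlgHom (lam p n K) (Polynomial.C (X j ^ p)) =
        Polynomial.C (∑ i ∈ Finset.range (K + 1), tau (PolyAlg p n) i ^ p *
          C (X j ^ p ^ (i + 1))) := by
      have : (lam p n K) (X j ^ p) = ∑ i ∈ Finset.range (K + 1), tau (PolyAlg p n) i ^ p *
          C (X j ^ p ^ (i + 1)) := by
        rw [map_pow, lam, aeval_X, sum_pow_char]
        refine Finset.sum_congr rfl fun i _ => ?_
        rw [mul_pow, ← map_pow, ← pow_mul, ← pow_succ]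
      rw [← this]
      simp [Polynomial.coe_mapAlgHom]
    have hX : Polynomial.mapAlgHom (lam p n K) Polynomial.X = Polynomial.X := by
      simp [Polynomial.coe_mapAlgHom]
    have hC : ∀ a : PolyAlg p n, psi p (PolyAlg p n) K (C a) = Polynomial.C (C a) := fun a => by
      rw [← algebraMap_eq, AlgHom.commutes]; rfl
    rw [hx, hxp, hX, lam, aeval_X, map_sum, Finset.sum_range_succ']
    simp only [map_mul, hC]
    have h0 : psi p (PolyAlg p n) K (tau (PolyAlg p n) 0) = 1 := by simp [tau]
    have hs : ∀ i ∈ Finset.range (K + 1),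
        psi p (PolyAlg p n) K (tau (PolyAlg p n) (i + 1)) =
          (if i + 1 ≤ K then Polynomial.C (tau (PolyAlg p n) (i + 1)) else 0) +
          Polynomial.X * Polynomial.C (tau (PolyAlg p n) i ^ p) := by
      intro i hi
      have hi' : i + 1 ≤ K + 1 := Finset.mem_range.1 hi
      have ht : tau (PolyAlg p n) (i + 1) = X i.succPNat := rfl
      rw [ht, psi, aeval_X]
      simp only [Nat.succPNat_coe, Nat.succ_eq_add_one, if_pos hi', Nat.add_sub_cancel]
      rfl
    rw [Finset.sum_congr rfl fun i hi => by rw [hs i hi, add_mul], Finset.sum_add_distrib, h0,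
      Finset.sum_range_succ]
    simp only [if_neg (Nat.not_succ_le_self K), zero_mul, add_zero]
    rw [Finset.sum_congr (g := fun i => Polynomial.C (tau (PolyAlg p n) (i + 1)) *
      Polynomial.C (C (X j ^ p ^ (i + 1)))) rfl fun i hi => by
        rw [if_pos (Nat.succ_le_of_lt (Finset.mem_range.1 hi))]]
    rw [Finset.sum_range_succ' (fun i => tau (PolyAlg p n) i * C (X j ^ p ^ i))]
    simp only [map_add, map_sum, map_mul, Finset.mul_sum, mul_assoc]
    simp only [tau, map_one]
    ring
  exact DFunLike.congr_fun key f

theorem psi_map {A B : Type*} [CommRing A] [CommRing B] (g : A →+* B) (K : ℕ)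
    (q : MvPolynomial ℕ+ A) :
    psi p B K (map g q) = (psi p A K q).map (map g) := by
  have htau : ∀ i, map g (tau A i) = tau B i := by
    intro i
    cases i <;> simp [tau]
  induction q using MvPolynomial.induction_on with
  | C a =>
    rw [map_C, ← algebraMap_eq, ← algebraMap_eq, AlgHom.commutes, AlgHom.commutes]
    change Polynomial.C (C (g a)) = Polynomial.map (map g) (Polynomial.C (C a))
    simp
  | add q r hq hr => simp only [map_add, Polynomial.map_add, hq, hr]
  | mul_X q i hq =>
    rw [map_mul, map_mul, map_mul, Polynomial.map_mul, hq, map_X]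
    congr 1
    rw [psi, psi, aeval_X, aeval_X, ← htau]
    split_ifs <;> simp

/-- Every monomial of `q` has total degree at least `d`. -/
def Low {B : Type*} [CommRing B] (d : ℕ) (q : Polynomial (MvPolynomial ℕ+ B)) : Prop :=
  ∀ (r : ℕ) (S : ℕ+ →₀ ℕ), coeff S (q.coeff r) ≠ 0 → d ≤ S.degree + r

theorem Low.mul {B : Type*} [CommRing B] {d e : ℕ} {q q' : Polynomial (MvPolynomial ℕ+ B)}
    (h : Low d q) (h' : Low e q') : Low (d + e) (q * q') := by
  classical
  intro r S hS
  rw [Polynomial.coeff_mul, coeff_sum] at hS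
  obtain ⟨a, ha, hS⟩ := Finset.exists_ne_zero_of_sum_ne_zero hS
  rw [coeff_mul] at hS
  obtain ⟨b, hb, hS⟩ := Finset.exists_ne_zero_of_sum_ne_zero hS
  have h1 := h _ _ (left_ne_zero_of_mul hS)
  have h2 := h' _ _ (right_ne_zero_of_mul hS)
  rw [Finset.HasAntidiagonal.mem_antidiagonal] at ha hb
  rw [← ha, ← hb, map_add]
  omega

theorem low_zero {B : Type*} [CommRing B] (q : Polynomial (MvPolynomial ℕ+ B)) : Low 0 q :=
  fun _ _ _ => Nat.zero_le _

theorem low_psi_X {B : Type*} [CommRing B] (K : ℕ) (i : ℕ+) : Low 1 (psi p B K (X i)) := by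
  classical
  intro r S hS
  by_contra hlt
  have hr : r = 0 := by omega
  have hS0 : S = 0 := by
    have : S.degree = 0 := by omega
    exact (Finsupp.degree_eq_zero_iff S).1 this
  subst hr hS0
  apply hS
  rw [psi, aeval_X]
  split_ifs <;> simp

theorem low_pow {B : Type*} [CommRing B] {d : ℕ} {q : Polynomial (MvPolynomial ℕ+ B)}
    (h : Low d q) (a : ℕ) : Low (a * d) (q ^ a) := by
  induction a with
  | zero => simpa using low_zero _
  | succ a ih =>
    rw [pow_succ, Nat.succ_mul]
    exact ih.mul h

theorem psi_monomial {B : Type*} [CommRing B] (K : ℕ) (R : ℕ+ →₀ ℕ) (i : ℕ+) :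
    psi p B K (monomial R 1) =
      psi p B K (X i) ^ R i * psi p B K (monomial (R.erase i) 1) := by
  rw [← map_pow, ← map_mul, X_pow_eq_monomial, monomial_mul, Finsupp.single_add_erase, one_mul]

/-- The coefficient of `s^r ξ^S` after substituting in `ξ^R`. -/
noncomputable def cc (p K : ℕ) (S : ℕ+ →₀ ℕ) (r : ℕ) (R : ℕ+ →₀ ℕ) : ZMod p :=
  coeff S ((psi p (ZMod p) K (monomial R 1)).coeff r)

theorem cc_bound {K : ℕ} {S : ℕ+ →₀ ℕ} {r : ℕ} {R : ℕ+ →₀ ℕ} (h : cc p K S r R ≠ 0) (i : ℕ+) :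
    R i ≤ S.degree + r := by
  rw [cc, psi_monomial K R i] at h
  simpa using ((low_pow (low_psi_X K i) (R i)).mul (low_zero _)) _ _ h

theorem cc_support {K : ℕ} {S : ℕ+ →₀ ℕ} {r : ℕ} {R : ℕ+ →₀ ℕ} (h : cc p K S r R ≠ 0) :
    ∀ i ∈ R.support, (i : ℕ) ≤ K + 1 := by
  intro i hi
  by_contra hlt
  apply h
  have : psi p (ZMod p) K (X i) = 0 := by
    rw [psi, aeval_X, if_neg (by omega), if_neg hlt, add_zero]
  rw [cc, psi_monomial K R i, this, zero_pow (Finsupp.mem_support_iff.1 hi)]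
  simp

theorem psi_coeff_zero {B : Type*} [CommRing B] (K : ℕ) (R : ℕ+ →₀ ℕ)
    (hR : ∀ i ∈ R.support, (i : ℕ) ≤ K) :
    (psi p B K (monomial R 1)).coeff 0 = monomial R 1 := by
  induction R using Finsupp.induction with
  | zero =>
    have : (monomial (0 : ℕ+ →₀ ℕ) (1 : B)) = 1 := rfl
    rw [this, map_one]; simp
  | single_add i a R hi ha ih =>
    have h1 : (i : ℕ) ≤ K := hR i (by
      simp [Finsupp.notMem_support_iff.1 hi, ha])
    have h2 : ∀ j ∈ R.support, (j : ℕ) ≤ K := fun j hj => hR j (by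
      simp only [Finsupp.mem_support_iff, Finsupp.add_apply] at hj ⊢; omega)
    have : (monomial (Finsupp.single i a + R) (1 : B)) = X i ^ a * monomial R 1 := by
      rw [X_pow_eq_monomial, monomial_mul, one_mul]
    rw [this, map_mul, Polynomial.mul_coeff_zero, ih h2, map_pow, psi, aeval_X, if_pos h1,
      ← Polynomial.constantCoeff_apply, map_pow]
    congr 2
    simp [if_pos (Nat.le_succ_of_le h1)]

theorem psi_X_top {B : Type*} [CommRing B] (K : ℕ) :
    psi p B K (X K.succPNat) = Polynomial.X * Polynomial.C (tau B K ^ p) := by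
  rw [psi, aeval_X]
  simp

/-- The exponent `p r` at position `K`, which is dropped when `K = 0`. -/
noncomputable def shift (K a : ℕ) : ℕ+ →₀ ℕ :=
  match K with
  | 0 => 0
  | i + 1 => Finsupp.single i.succPNat a

theorem tau_pow (B : Type*) [CommRing B] (K a : ℕ) :
    tau B K ^ a = monomial (shift K a) 1 := by
  cases K with
  | zero => rw [tau, one_pow]; rfl
  | succ i => rw [tau, X_pow_eq_monomial]; rfl

theorem cc_lt {K : ℕ} {S : ℕ+ →₀ ℕ} {r : ℕ} {R : ℕ+ →₀ ℕ}
    (hr : r < R K.succPNat) : cc p K S r R = 0 := by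
  rw [cc, psi_monomial K R K.succPNat, psi_X_top, mul_pow, mul_assoc,
    Polynomial.coeff_X_pow_mul', if_neg (by omega), coeff_zero]

theorem cc_eq {K : ℕ} {S : ℕ+ →₀ ℕ} {R : ℕ+ →₀ ℕ}
    (hR : ∀ i ∈ R.support, (i : ℕ) ≤ K + 1) :
    cc p K S (R K.succPNat) R =
      if shift K (p * R K.succPNat) + R.erase K.succPNat = S then 1 else 0 := by
  classical
  have hE : ∀ i ∈ (R.erase K.succPNat).support, (i : ℕ) ≤ K := by
    intro i hi
    rw [Finsupp.support_erase, Finset.mem_erase] at hi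
    have h1 := hR i hi.2
    have h2 : (i : ℕ) ≠ K + 1 := fun h => hi.1 (PNat.eq h)
    omega
  rw [cc, psi_monomial K R K.succPNat, psi_X_top, mul_pow, mul_assoc,
    Polynomial.coeff_X_pow_mul', if_pos le_rfl, Nat.sub_self, Polynomial.mul_coeff_zero,
    psi_coeff_zero K _ hE, ← Polynomial.C_pow, Polynomial.coeff_C_zero, ← pow_mul, tau_pow,
    monomial_mul, one_mul, coeff_monomial]

theorem comp_eq [Fact p.Prime] (K : ℕ) (S : ℕ+ →₀ ℕ) (hS : ∀ i ∈ S.support, (i : ℕ) ≤ K) (r : ℕ)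
    (F : Finset (ℕ+ →₀ ℕ)) (hF : ∀ R, cc p K S r R ≠ 0 → R ∈ F) :
    milnorOperation p S * steenrodPower p r = ∑ R ∈ F, cc p K S r R • milnorOperation p R := by
  classical
  funext n
  refine LinearMap.ext fun f => ?_
  rw [Finset.sum_apply, LinearMap.sum_apply]
  have hL : (milnorOperation p S * steenrodPower p r) n f =
      coeff S ((psi p (PolyAlg p n) K (lam p n (K + 1) f)).coeff r) := by
    rw [psi_lam, Polynomial.coeff_map]
    change MvPowerSeries.coeff S (milnorCoaction p n ((totalPower p n f).coeff r)) = _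
    rw [lam_coeff n K _ S hS]
    rfl
  have hc : ∀ R : ℕ+ →₀ ℕ, coeff S ((psi p (PolyAlg p n) K (monomial R 1)).coeff r) =
      algebraMap (ZMod p) (PolyAlg p n) (cc p K S r R) := by
    intro R
    have : (monomial R (1 : PolyAlg p n)) =
        map (algebraMap (ZMod p) (PolyAlg p n)) (monomial R 1) := by simp
    rw [this, psi_map, Polynomial.coeff_map, coeff_map, cc]
  have hR : ∀ R, (cc p K S r R • milnorOperation p R) n f =
      cc p K S r R • coeff R (lam p n (K + 1) f) := by
    intro R
    by_cases h : cc p K S r R = 0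
    · rw [h, zero_smul, zero_smul]; rfl
    · rw [← lam_coeff n (K + 1) f R (cc_support h)]
      rfl
  rw [hL]
  conv_lhs => rw [(lam p n (K + 1) f).as_sum, map_sum, Polynomial.finsetSum_coeff, coeff_sum]
  have hterm : ∀ R, coeff S ((psi p (PolyAlg p n) K
      (monomial R (coeff R (lam p n (K + 1) f)))).coeff r) =
      cc p K S r R • coeff R (lam p n (K + 1) f) := by
    intro R
    have : monomial R (coeff R (lam p n (K + 1) f)) =
        coeff R (lam p n (K + 1) f) • monomial R (1 : PolyAlg p n) := by
      rw [smul_monomial, smul_eq_mul, mul_one]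
    rw [this, map_smul, Polynomial.coeff_smul, coeff_smul, hc, smul_eq_mul, mul_comm,
      Algebra.smul_def]
  simp only [hterm]
  rw [Finset.sum_congr rfl fun R _ => hR R]
  refine (Finset.sum_subset Finset.subset_union_left fun R _ h => ?_).trans
    (Finset.sum_subset (Finset.subset_union_right (s₁ := (lam p n (K + 1) f).support))
      fun R _ h => ?_).symm
  · rw [notMem_support_iff.1 h, smul_zero]
  · rw [by_contra fun h' => h (hF R h'), zero_smul]

theorem mem_aux [Fact p.Prime] (K : ℕ) : ∀ R : ℕ+ →₀ ℕ, (∀ i ∈ R.support, (i : ℕ) ≤ K) →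
    milnorOperation p R ∈ steenrodAlgebra p := by
  classical
  induction K with
  | zero =>
    intro R hR
    have hR0 : R = 0 := by
      rw [← Finsupp.support_eq_empty, Finset.eq_empty_iff_forall_notMem]
      intro i hi
      have := hR i hi
      have := i.pos
      omega
    have : milnorOperation p R = 1 := by
      funext n
      refine LinearMap.ext fun f => ?_
      change MvPowerSeries.coeff R (milnorCoaction p n f) = f
      rw [lam_coeff n 0 f R hR, hR0]
      have : lam p n 0 f = C f := by
        have : lam p n 0 = Algebra.algHom (ZMod p) (PolyAlg p n) (MvPolynomial ℕ+ (PolyAlg p n)) := by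
          refine MvPolynomial.algHom_ext fun j => ?_
          rw [lam, aeval_X]
          simp only [zero_add, Finset.range_one, Finset.sum_singleton, tau, pow_zero, pow_one,
            one_mul]
          rfl
        rw [this]; rfl
      rw [this]; simp
    rw [this]
    exact one_mem _
  | succ K ihK =>
    have main : ∀ (r : ℕ) (R : ℕ+ →₀ ℕ), R K.succPNat = r →
        (∀ i ∈ R.support, (i : ℕ) ≤ K + 1) → milnorOperation p R ∈ steenrodAlgebra p := by
      intro r
      induction r using Nat.strong_induction_on with
      | _ r ih =>
      intro R hr hR
      set S : ℕ+ →₀ ℕ := shift K (p * r) + R.erase K.succPNat with hSdef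
      have hS : ∀ i ∈ S.support, (i : ℕ) ≤ K := by
        intro i hi
        rcases Finset.mem_union.1 (Finsupp.support_add hi) with h | h
        · cases K with
          | zero => simp [shift] at h
          | succ k =>
            have := Finset.mem_singleton.1 (Finsupp.support_single_subset h)
            rw [this]; rfl
        · rw [Finsupp.support_erase, Finset.mem_erase] at h
          have h1 := hR i h.2
          have h2 : (i : ℕ) ≠ K + 1 := fun h' => h.1 (PNat.eq h')
          omega
      let F : Finset (ℕ+ →₀ ℕ) := (Finset.Icc 1 K.succPNat).finsupp
        fun _ => Finset.range (S.degree + r + 1)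
      have hF : ∀ Q, cc p K S r Q ≠ 0 → Q ∈ F := by
        intro Q hQ
        rw [Finset.mem_finsupp_iff]
        refine ⟨fun i hi => ?_, fun i _ => ?_⟩
        · exact Finset.mem_Icc.2 ⟨one_le, cc_support hQ i hi⟩
        · exact Finset.mem_range.2 (Nat.lt_succ_of_le (cc_bound hQ i))
      have hcR : cc p K S r R = 1 := by
        have := cc_eq (p := p) (S := S) hR
        rw [hr, if_pos hSdef.symm] at this
        exact this
      have h1 : Nontrivial (ZMod p) := inferInstance
      have hRF : R ∈ F := hF R (by rw [hcR]; exact one_ne_zero)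
      have hcomp := comp_eq K S hS r F hF
      rw [← Finset.add_sum_erase F _ hRF, hcR, one_smul] at hcomp
      rw [← sub_eq_iff_eq_add] at hcomp
      rw [← hcomp]
      refine sub_mem (mul_mem (ihK S hS) (Algebra.subset_adjoin ⟨r, rfl⟩))
        (sum_mem fun Q hQ => ?_)
      by_cases hc : cc p K S r Q = 0
      · rw [hc, zero_smul]; exact zero_mem _
      · refine Subalgebra.smul_mem _ ?_ _
        have hsup := cc_support hc
        rcases lt_trichotomy (Q K.succPNat) r with h | h | h
        · exact ih _ h Q rfl hsup
        · exfalso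
          have he := cc_eq (p := p) (S := S) hsup
          rw [h] at he
          rw [he] at hc
          have hS' : shift K (p * r) + Q.erase K.succPNat = S := by
            by_contra h'
            exact hc (if_neg h')
          rw [hSdef] at hS'
          have hEr := add_left_cancel hS'
          apply (Finset.mem_erase.1 hQ).1
          rw [← Finsupp.single_add_erase K.succPNat Q, hEr, h, ← hr,
            Finsupp.single_add_erase]
        · exact absurd (cc_lt h) hc
    exact fun R hR => main _ R rfl hR

end MilnorAux

theorem milnorOperation_mem (p : ℕ) [Fact p.Prime] (R : ℕ+ →₀ ℕ) :
    milnorOperation p R ∈ steenrodAlgebra p :=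
  MilnorAux.mem_aux (R.support.sup (fun i => (i : ℕ))) R fun _ hi =>
    Finset.le_sup (f := fun i : ℕ+ => (i : ℕ)) hi

/-- The Milnor basis element `P(R)` of `𝒜_p`, for a finite sequence `R = (r_1, r_2, …)` of
non-negative integers: the element of `𝒜_p` dual to `ξ^R` in the monomial basis of the dual
algebra `𝔽_p[ξ_1, ξ_2, …]`. -/
noncomputable def milnorBasis (p : ℕ) [Fact p.Prime] (R : ℕ+ →₀ ℕ) : steenrodAlgebra p :=
  ⟨milnorOperation p R, milnorOperation_mem p R⟩

/-- The determinant `[x_1^{s_1}, …, x_n^{s_n}]`, whose `(i, j)` entry is `x_j^{s_i}`. -/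
noncomputable def bracket (p : ℕ) {n : ℕ} (s : Fin n → ℕ) : PolyAlg p n :=
  Matrix.det (Matrix.of fun i j : Fin n => (X j : PolyAlg p n) ^ s i)

/-!
Write `ξ_0 = 1`. The value of `P(R)` on `(x_1 ⋯ x_n)^(p-1)` is the coefficient of `ξ^R` in
`∏_j (∑_k x_j^(p^k) ξ_k)^(p-1)`. Treating `ξ_0` as a further variable makes this product
homogeneous of degree `n(p-1)`, and setting `ξ_0 = 1` loses nothing, since the exponent of `ξ_0` in
a monomial is determined by the other exponents (`coeff_aeval_tau`). That exponent is `0` if `m = n`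
and `p-1` if `m = n-1`. In both cases the coefficient sought is therefore that of
`∏_i ξ_{s_i}^(p-1)` for distinct indices `s_1, …, s_n ≥ 0`, with `s_1 = 0` in the second case, and
the claim is that it equals `det(x_j^(p^(s_i)))^(p-1)` (`milnorBasis_smul_prod_pow`).

Two facts about sums over `𝔽_p^n` give this.

* The sum `∑_a a^k` over `a ∈ 𝔽_p` vanishes if `k < p-1` and is `-1` if `k = p-1`. Hence summing a
  homogeneous polynomial of degree `n(p-1)` over all `𝔽_p`-values of `ξ_{s_1}, …, ξ_{s_n}`, the other
  variables being `0`, gives `(-1)^n` times the coefficient of `∏_i ξ_{s_i}^(p-1)`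
  (`coeff_eq_sum_eval`).
* For every `n × n` matrix `A` over a commutative `𝔽_p`-algebra,
  `∑_y ∏_j (yA)_j^(p-1) = (-1)^n det(A)^(p-1)`, with `y` ranging over `𝔽_p^n`
  (`sum_prod_vecMul_pow`). Both sides have degree at most `p-1` in each entry of `A`, so it is
  enough to compare them for `A` over `𝔽_p`. If `A` is invertible then `y ↦ yA` permutes `𝔽_p^n`;
  if not, all fibres of `y ↦ yA` have a number of elements divisible by `p`.
-/

/-! ### Sums over `𝔽_p^n` and determinants -/

theorem sum_pow_sub_one (p : ℕ) [Fact p.Prime] : ∑ a : ZMod p, a ^ (p - 1) = -1 := by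
  classical
  have hp := (Fact.out : p.Prime).two_le
  have h : ∀ a : ZMod p, a ^ (p - 1) = if a = 0 then 0 else 1 := fun a => by
    split_ifs with h
    · rw [h, zero_pow (by omega)]
    · exact ZMod.pow_card_sub_one_eq_one h
  simp only [h, Finset.sum_ite, Finset.sum_const_zero, zero_add, Finset.sum_const, nsmul_one]
  rw [Finset.filter_ne' Finset.univ (0 : ZMod p),
    Finset.card_erase_of_mem (Finset.mem_univ _), Finset.card_univ, ZMod.card,
    Nat.cast_sub (by omega)]
  simp

/-- The non-empty fibres of `y ↦ yA` have as many elements as its kernel, a non-trivial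
`𝔽_p`-vector space. -/
theorem sum_vecMul_eq_zero {p : ℕ} [Fact p.Prime] {ι : Type*} [Fintype ι] [DecidableEq ι]
    {A : Matrix ι ι (ZMod p)} (hA : A.det = 0) (g : (ι → ZMod p) → ZMod p) :
    ∑ y : ι → ZMod p, g (Matrix.vecMul y A) = 0 := by
  classical
  obtain ⟨v, hv, hvA⟩ := Matrix.exists_vecMul_eq_zero_iff.2 hA
  let φ : (ι → ZMod p) →+ (ι → ZMod p) := (Matrix.vecMulLinear A).toAddMonoidHom
  have hφ : ∀ y, φ y = Matrix.vecMul y A := fun _ => rfl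
  have hker : p ∣ Fintype.card φ.ker := by
    let w : φ.ker := ⟨v, hvA⟩
    have hw : addOrderOf w = p := addOrderOf_eq_prime (by ext; simp [w])
      (fun h => hv (congrArg Subtype.val h))
    exact hw.symm.dvd.trans addOrderOf_dvd_card
  simp only [← hφ]
  rw [Finset.sum_comp]
  refine Finset.sum_eq_zero fun z hz => ?_
  obtain ⟨y, -, rfl⟩ := Finset.mem_image.1 hz
  rw [AddMonoidHom.card_fiber_eq_of_mem_range φ ⟨y, rfl⟩ ⟨0, map_zero φ⟩]
  have : Finset.card {g | φ g = 0} = Fintype.card φ.ker := by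
    rw [Fintype.card_subtype]
    simp only [AddMonoidHom.mem_ker]
  rw [this, nsmul_eq_mul, (ZMod.natCast_eq_zero_iff _ _).2 hker, zero_mul]

theorem sum_prod_vecMul_pow_zmod {p : ℕ} [Fact p.Prime] {ι : Type*} [Fintype ι] [DecidableEq ι]
    (A : Matrix ι ι (ZMod p)) :
    ∑ y : ι → ZMod p, ∏ j, Matrix.vecMul y A j ^ (p - 1) =
      (-1) ^ Fintype.card ι * A.det ^ (p - 1) := by
  have hp := (Fact.out : p.Prime).two_le
  by_cases hA : A.det = 0
  · rw [sum_vecMul_eq_zero hA fun z => ∏ j, z j ^ (p - 1), hA, zero_pow (by omega), mul_zero]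
  · have hbij : Function.Bijective fun y : ι → ZMod p => Matrix.vecMul y A :=
      Finite.injective_iff_bijective.1
        (Matrix.vecMul_injective_iff_isUnit.2 ((Matrix.isUnit_iff_isUnit_det A).2 (.mk0 _ hA)))
    rw [hbij.sum_comp fun z : ι → ZMod p => ∏ j, z j ^ (p - 1), ZMod.pow_card_sub_one_eq_one hA,
      ← Fintype.prod_sum fun (_ : ι) (a : ZMod p) => a ^ (p - 1)]
    simp [sum_pow_sub_one]

/-- For matrices with entries in `𝔽_p` this is `sum_prod_vecMul_pow_zmod`. The two sides, taken for
the generic matrix, are polynomials of degree at most `p - 1` in each entry, so they are determined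
by their values at the matrices over `𝔽_p`; the general case is a specialization. The index type
lies in `Type` because `MvPolynomial.eq_zero_of_eval_eq_zero` puts the variables into the universe of
the coefficient field. -/
theorem sum_prod_vecMul_pow {p : ℕ} [Fact p.Prime] {ι : Type} {B : Type*} [Fintype ι] [DecidableEq ι]
    [CommRing B] [Algebra (ZMod p) B] (A : Matrix ι ι B) :
    ∑ y : ι → ZMod p, ∏ j, (∑ i, algebraMap (ZMod p) B (y i) * A i j) ^ (p - 1) =
      (-1) ^ Fintype.card ι * A.det ^ (p - 1) := by
  classical
  have hX : ∀ s : ι × ι, ∀ i j : ι,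
      degreeOf s (X (i, j) : MvPolynomial (ι × ι) (ZMod p)) ≤ if s.2 = j then 1 else 0 := by
    rintro s i j
    rw [degreeOf_X]
    split_ifs <;> simp_all
  -- In a product over the columns, only the factor of column `s.2` involves the variable `s`.
  have hprod : ∀ (s : ι × ι) (d : ℕ) (f : ι → MvPolynomial (ι × ι) (ZMod p)),
      (∀ j, degreeOf s (f j) ≤ if s.2 = j then d else 0) → degreeOf s (∏ j, f j) ≤ d := by
    intro s d f hf
    refine (degreeOf_prod_le s _ f).trans ((Finset.sum_le_sum fun j _ => hf j).trans ?_)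
    simp
  have key : (∑ y : ι → ZMod p, ∏ j, (∑ i, C (y i) * X (i, j)) ^ (p - 1) :
      MvPolynomial (ι × ι) (ZMod p)) -
      C ((-1) ^ Fintype.card ι) * (Matrix.mvPolynomialX ι ι (ZMod p)).det ^ (p - 1) = 0 := by
    apply eq_zero_of_eval_eq_zero (ι × ι) (ZMod p)
    · intro v
      have h := sum_prod_vecMul_pow_zmod (Matrix.of fun i j => v (i, j))
      have hd : eval v (Matrix.mvPolynomialX ι ι (ZMod p)).det =
          (Matrix.of fun i j => v (i, j)).det := by
        rw [RingHom.map_det]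
        congr 1
        ext i j
        simp
      rw [map_sub, map_mul, map_pow (eval v) _ (p - 1), hd, eval_C, ← h, sub_eq_zero]
      simp [Matrix.vecMul, dotProduct]
    · rw [ZMod.card, mem_restrictDegree]
      intro e he s
      refine (le_degreeOf_of_mem_support s he).trans ?_
      refine (degreeOf_sub_le s _ _).trans (max_le ?_ ?_)
      · refine (degreeOf_sum_le s _ _).trans (Finset.sup_le fun y _ => hprod s _ _ fun j => ?_)
        refine (degreeOf_pow_le s _ _).trans ?_
        have : degreeOf s (∑ i, C (y i) * X (i, j)) ≤ if s.2 = j then 1 else 0 :=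
          (degreeOf_sum_le s _ _).trans (Finset.sup_le fun i _ =>
            (degreeOf_C_mul_le _ _ _).trans (hX s i j))
        calc _ ≤ (p - 1) * (if s.2 = j then 1 else 0) := Nat.mul_le_mul_left _ this
          _ = _ := by split_ifs <;> simp
      · refine (degreeOf_C_mul_le _ _ _).trans ((degreeOf_pow_le s _ _).trans ?_)
        refine (Nat.mul_le_mul_left _ ?_).trans_eq (mul_one _)
        rw [Matrix.det_apply]
        refine (degreeOf_sum_le s _ _).trans (Finset.sup_le fun σ _ => ?_)
        rw [Units.smul_def, ← Int.cast_smul_eq_zsmul (ZMod p), smul_eq_C_mul]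
        exact (degreeOf_C_mul_le _ _ _).trans (hprod s _ _ fun j => by
          simpa using hX s (σ j) j)
  have h := congrArg (aeval fun s : ι × ι => A s.1 s.2) key
  have hd : aeval (fun s : ι × ι => A s.1 s.2) (Matrix.mvPolynomialX ι ι (ZMod p)).det =
      A.det := by
    rw [AlgHom.map_det]
    congr 1
    ext i j
    simp
  rw [map_sub, map_zero, sub_eq_zero, map_mul, map_pow _ _ (p - 1), hd] at h
  simpa [map_sum, map_prod, algHom_C] using h

/-! ### Coefficients of homogeneous polynomials -/

/-- A monomial sums to zero over `𝔽_p^n` unless each summed variable has exponent at least `p - 1`,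
and it vanishes pointwise if it involves any other variable. In degree `n(p-1)` this leaves only the
monomial in which the summed variables all have exponent `p - 1`. -/
theorem coeff_eq_sum_eval {p : ℕ} [Fact p.Prime] {ι κ B : Type*} [Fintype ι] [DecidableEq ι]
    [DecidableEq κ]
    [CommRing B] [Algebra (ZMod p) B] {s : ι → κ} (hs : Function.Injective s) {e : κ →₀ ℕ}
    (he : ∀ i, e (s i) = p - 1) (he' : ∀ k ∉ Set.range s, e k = 0)
    {G : MvPolynomial κ B} (hG : G.IsHomogeneous (Fintype.card ι * (p - 1))) :
    ∑ y : ι → ZMod p,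
      eval (fun k => algebraMap (ZMod p) B (∑ i, if s i = k then y i else 0)) G =
      (-1) ^ Fintype.card ι * coeff e G := by
  classical
  have hp := (Fact.out : p.Prime).two_le
  have hmon : ∀ q : κ →₀ ℕ, q.degree = Fintype.card ι * (p - 1) →
      ∑ y : ι → ZMod p, q.prod (fun k a => (∑ i, if s i = k then y i else 0) ^ a) =
        if q = e then (-1) ^ Fintype.card ι else 0 := by
    intro q hq
    by_cases hsupp : ∃ k ∈ q.support, k ∉ Set.range s
    · obtain ⟨k, hk, hks⟩ := hsupp
      rw [if_neg]
      · refine Finset.sum_eq_zero fun y _ => Finset.prod_eq_zero hk ?_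
        beta_reduce
        rw [Finset.sum_eq_zero fun i _ => if_neg fun h => hks ⟨i, h⟩,
          zero_pow (Finsupp.mem_support_iff.1 hk)]
      · rintro rfl
        exact Finsupp.mem_support_iff.1 hk (he' k hks)
    · push Not at hsupp
      have hsub : q.support ⊆ Finset.univ.image s := fun k hk => by
        obtain ⟨i, hi⟩ := hsupp k hk
        exact Finset.mem_image.2 ⟨i, Finset.mem_univ _, hi⟩
      have hdeg : ∑ i, q (s i) = Fintype.card ι * (p - 1) := by
        rw [← hq, Finsupp.degree_apply, Finset.sum_subset hsub fun k _ h =>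
          Finsupp.notMem_support_iff.1 h, Finset.sum_image hs.injOn]
      have hy : ∀ y : ι → ZMod p,
          q.prod (fun k a => (∑ i, if s i = k then y i else 0) ^ a) = ∏ i, y i ^ q (s i) := by
        intro y
        rw [Finsupp.prod_of_support_subset _ hsub _ fun _ _ => pow_zero _,
          Finset.prod_image hs.injOn]
        simp [hs.eq_iff]
      simp only [hy]
      rw [← Fintype.prod_sum fun (i : ι) (a : ZMod p) => a ^ q (s i)]
      by_cases hlt : ∃ i, q (s i) < p - 1
      · obtain ⟨i, hi⟩ := hlt
        rw [if_neg]
        · exact Finset.prod_eq_zero (Finset.mem_univ i)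
            (FiniteField.sum_pow_lt_card_sub_one (ZMod p) _ (by rwa [ZMod.card]))
        · rintro rfl
          exact hi.ne (he i)
      · push Not at hlt
        have heq : ∀ i, q (s i) = p - 1 := by
          have := (Finset.sum_eq_sum_iff_of_le (s := Finset.univ) fun i _ => hlt i).1
            (by rw [hdeg]; simp)
          exact fun i => (this i (Finset.mem_univ i)).symm
        rw [if_pos]
        · simp [heq, sum_pow_sub_one]
        · ext k
          by_cases hk : k ∈ Set.range s
          · obtain ⟨i, rfl⟩ := hk
            rw [heq, he]
          · rw [he' k hk]
            by_contra h
            exact hk (hsupp k (Finsupp.mem_support_iff.2 h))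
  have hev : ∀ y : ι → ZMod p,
      eval (fun k => algebraMap (ZMod p) B (∑ i, if s i = k then y i else 0)) G =
      ∑ q ∈ G.support, coeff q G * algebraMap (ZMod p) B
        (q.prod fun k a => (∑ i, if s i = k then y i else 0) ^ a) := by
    intro y
    rw [eval_eq]
    simp only [Finsupp.prod, map_prod, map_pow]
  simp only [hev]
  rw [Finset.sum_comm]
  simp only [← Finset.mul_sum, ← map_sum]
  rw [Finset.sum_congr rfl fun q hq => by
    rw [hmon q (by
      rw [Finsupp.degree_eq_weight_one]
      exact hG (mem_support_iff.1 hq))]]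
  simp only [apply_ite (algebraMap (ZMod p) B), map_zero, mul_ite, mul_zero,
    Finset.sum_ite_eq']
  split_ifs with h
  · simp [mul_comm]
  · rw [notMem_support_iff.1 h, mul_zero]

/-- Setting the variable with index `0` to `1` deletes the exponent at `0`. -/
theorem aeval_tau_monomial {B : Type*} [CommRing B] (e : ℕ →₀ ℕ) (a : B) :
    aeval (MilnorAux.tau B) (monomial e a) =
      monomial (e.comapDomain ((↑) : ℕ+ → ℕ) PNat.coe_injective.injOn) a := by
  induction e using Finsupp.induction_linear generalizing a with
  | zero => simp
  | add e f he hf =>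
    have : (monomial (e + f) a : MvPolynomial ℕ B) = monomial e a * monomial f 1 := by
      rw [monomial_mul, mul_one]
    rw [this, map_mul, he, hf, monomial_mul, mul_one]
    exact congrArg (monomial · a) (Finsupp.ext fun _ => rfl)
  | single i k =>
    rw [aeval_monomial, algebraMap_eq,
      Finsupp.prod_single_index (h := fun i k => MilnorAux.tau B i ^ k) (pow_zero _)]
    cases i with
    | zero =>
      rw [MilnorAux.tau, one_pow, mul_one, C_apply]
      exact congrArg (monomial · a) (Finsupp.ext fun j => by simp)
    | succ i =>
      rw [MilnorAux.tau, X_pow_eq_monomial, C_mul_monomial, mul_one]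
      refine congrArg (monomial · a) (Finsupp.ext fun j => ?_)
      simp [Finsupp.single_apply, ← PNat.coe_inj]

/-- Dehomogenization with respect to the variable with index `0` does not merge any two monomials
of a homogeneous polynomial, so it preserves coefficients. -/
theorem coeff_aeval_tau {B : Type*} [CommRing B] {d : ℕ} {G : MvPolynomial ℕ B}
    (hG : G.IsHomogeneous d) {e : ℕ →₀ ℕ} (he : e.degree = d) :
    coeff (e.comapDomain ((↑) : ℕ+ → ℕ) PNat.coe_injective.injOn)
      (aeval (MilnorAux.tau B) G) = coeff e G := by
  classical
  conv_lhs => rw [G.as_sum, map_sum, coeff_sum]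
  rw [Finset.sum_congr rfl fun q hq => by
    rw [aeval_tau_monomial, coeff_monomial]]
  rw [Finset.sum_eq_single e]
  · rw [if_pos rfl]
  · intro q hq hne
    rw [if_neg]
    intro h
    apply hne
    have hE : q.erase 0 = e.erase 0 := by
      ext i
      cases i with
      | zero => simp
      | succ i =>
        have := DFunLike.congr_fun h i.succPNat
        simpa using this
    have hqd : q.degree = d := by
      rw [Finsupp.degree_eq_weight_one]
      exact hG (mem_support_iff.1 hq)
    have h0 : q 0 = e 0 := by
      have h1 := congrArg Finsupp.degree (Finsupp.single_add_erase 0 q)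
      have h2 := congrArg Finsupp.degree (Finsupp.single_add_erase 0 e)
      rw [map_add, Finsupp.degree_single] at h1 h2
      rw [hE] at h1
      omega
    rw [← Finsupp.single_add_erase 0 q, hE, h0, Finsupp.single_add_erase]
  · intro h
    rw [if_pos rfl, notMem_support_iff.1 h]

/-! ### The action of `P(R)` -/

/-- A common form of the two cases of the theorem: here `e` is the exponent sequence `R` with an
exponent of `ξ_0 = 1` added so that the total degree is `n(p-1)`. -/
theorem milnorBasis_smul_prod_pow {p n : ℕ} [Fact p.Prime] {s : Fin n → ℕ}
    (hs : Function.Injective s) {e : ℕ →₀ ℕ} (he : ∀ i, e (s i) = p - 1)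
    (he' : ∀ k ∉ Set.range s, e k = 0) {R : ℕ+ →₀ ℕ} (hR : ∀ i : ℕ+, R i = e i) :
    milnorBasis p R • ((∏ j : Fin n, X j : PolyAlg p n) ^ (p - 1)) =
      bracket p (fun i => p ^ s i) ^ (p - 1) := by
  classical
  obtain ⟨K, hK⟩ : ∃ K, ∀ k ∈ e.support, k ≤ K :=
    ⟨e.support.sup id, fun k hk => Finset.le_sup (f := id) hk⟩
  have hp := (Fact.out : p.Prime).two_le
  have hsK : ∀ i, s i ∈ Finset.range (K + 1) := fun i => Finset.mem_range.2 (Nat.lt_succ_of_le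
    (hK _ (Finsupp.mem_support_iff.2 (by rw [he]; omega))))
  have hRe : R = e.comapDomain ((↑) : ℕ+ → ℕ) PNat.coe_injective.injOn := by
    ext i
    rw [hR, Finsupp.comapDomain_apply]
  have hdeg : e.degree = n * (p - 1) := by
    have hsub : e.support ⊆ Finset.univ.image s := fun k hk => by
      by_contra h
      exact Finsupp.mem_support_iff.1 hk (he' k fun ⟨i, hi⟩ =>
        h (Finset.mem_image.2 ⟨i, Finset.mem_univ _, hi⟩))
    rw [Finsupp.degree_apply, Finset.sum_subset hsub fun k _ h =>
      Finsupp.notMem_support_iff.1 h, Finset.sum_image hs.injOn]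
    simp [he]
  -- The coaction on `(x_1 ⋯ x_n)^(p-1)` with `ξ_0` as a variable and `ξ_i = 0` for `i > K`.
  let G : MvPolynomial ℕ (PolyAlg p n) :=
    (∏ j : Fin n, ∑ i ∈ Finset.range (K + 1), C (X j ^ p ^ i) * X i) ^ (p - 1)
  have hG : G.IsHomogeneous (n * (p - 1)) := by
    refine IsHomogeneous.pow ?_ _
    have := IsHomogeneous.prod Finset.univ
      (fun j : Fin n => (∑ i ∈ Finset.range (K + 1), C (X j ^ p ^ i) * X i :
        MvPolynomial ℕ (PolyAlg p n))) (fun _ => 1)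
      fun j _ => IsHomogeneous.sum _ _ _ fun i _ => (isHomogeneous_X _ i).C_mul _
    simpa using this
  have hlam : MilnorAux.lam p n K ((∏ j : Fin n, X j : PolyAlg p n) ^ (p - 1)) =
      aeval (MilnorAux.tau (PolyAlg p n)) G := by
    simp only [G, MilnorAux.lam, map_pow, map_prod, map_sum, map_mul, aeval_X, aeval_C,
      algebraMap_eq]
    simp only [mul_comm]
  change MvPowerSeries.coeff R (milnorCoaction p n _) = _
  rw [MilnorAux.lam_coeff n K _ R fun i hi => hK _ (by
    simpa [hR] using hi), hlam, hRe, coeff_aeval_tau hG hdeg]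
  have h1 := coeff_eq_sum_eval hs he he' (by simpa using hG)
  have h2 := sum_prod_vecMul_pow (p := p)
    (Matrix.of fun i j : Fin n => (X j : PolyAlg p n) ^ p ^ s i)
  have h3 : ∀ y : Fin n → ZMod p,
      eval (fun k => algebraMap (ZMod p) (PolyAlg p n) (∑ i, if s i = k then y i else 0)) G =
      ∏ j, (∑ i, algebraMap (ZMod p) (PolyAlg p n) (y i) *
        (Matrix.of fun i j : Fin n => (X j : PolyAlg p n) ^ p ^ s i) i j) ^ (p - 1) := by
    intro y
    simp only [G, map_pow, map_prod, map_sum, map_mul, eval_X, eval_C, ← Finset.prod_pow]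
    refine Finset.prod_congr rfl fun j _ => ?_
    congr 1
    simp only [Finset.mul_sum, apply_ite (algebraMap (ZMod p) (PolyAlg p n)), map_zero, mul_ite,
      mul_zero]
    rw [Finset.sum_comm]
    refine Finset.sum_congr rfl fun i _ => ?_
    rw [Finset.sum_ite_eq, if_pos (hsK i), mul_comm, Matrix.of_apply]
  simp only [h3] at h1
  rw [h2] at h1
  have hunit : IsUnit ((-1 : PolyAlg p n) ^ Fintype.card (Fin n)) := (isUnit_one.neg).pow _
  exact (hunit.mul_left_cancel h1).symm

theorem mainTheorem12 (p : ℕ) [Fact p.Prime] (hp : p ≠ 2) (m : ℕ) (b : Fin m → ℕ+)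
    (hb : Function.Injective b) (R : ℕ+ →₀ ℕ)
    (hR : ∀ i ∈ Set.range b, R i = p - 1) (hR' : ∀ i ∉ Set.range b, R i = 0) :
    (milnorBasis p R • ((∏ j : Fin m, X j : PolyAlg p m) ^ (p - 1)) =
      bracket p (fun i : Fin m => p ^ (b i : ℕ)) ^ (p - 1)) ∧
    (milnorBasis p R • ((∏ j : Fin (m + 1), X j : PolyAlg p (m + 1)) ^ (p - 1)) =
      bracket p (Fin.cons 1 fun i : Fin m => p ^ (b i : ℕ)) ^ (p - 1)) := by
  classical
  have hinj : Function.Injective fun i => (b i : ℕ) := PNat.coe_injective.comp hb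
  -- The exponents `R`, indexed by `ℕ` with exponent `0` at `ξ_0`.
  let E : ℕ →₀ ℕ := R.mapDomain ((↑) : ℕ+ → ℕ)
  have hE : ∀ i : ℕ+, E i = R i := fun i => Finsupp.mapDomain_apply PNat.coe_injective _ _
  have hE0 : E 0 = 0 := Finsupp.mapDomain_of_notMem_range _ _ fun ⟨i, hi⟩ => i.ne_zero hi
  have hE' : ∀ k, k ∉ Set.range (fun i => (b i : ℕ)) → E k = 0 := by
    intro k hk
    cases k with
    | zero => exact hE0
    | succ k =>
      rw [← Nat.succ_eq_add_one, ← Nat.succPNat_coe, hE]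
      exact hR' _ fun ⟨i, hi⟩ => hk ⟨i, by simp [hi]⟩
  constructor
  · exact milnorBasis_smul_prod_pow (e := E) hinj (fun i => by rw [hE, hR _ ⟨i, rfl⟩]) hE'
      fun i => (hE i).symm
  -- The first row of the bracket has exponent `1 = p ^ 0`, and `ξ_0` has exponent `p - 1`.
  · let s : Fin (m + 1) → ℕ := Fin.cons 0 fun i => (b i : ℕ)
    have hs : Function.Injective s :=
      Fin.cons_injective_iff.2 ⟨fun ⟨i, hi⟩ => (b i).ne_zero hi, hinj⟩
    have hps : (Fin.cons 1 fun i : Fin m => p ^ (b i : ℕ) : Fin (m + 1) → ℕ) =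
        fun i => p ^ s i := by
      ext i
      refine Fin.cases ?_ (fun i => ?_) i <;> simp [s]
    rw [hps]
    refine milnorBasis_smul_prod_pow (e := Finsupp.single 0 (p - 1) + E) hs ?_ ?_ ?_
    · intro i
      refine Fin.cases ?_ (fun i => ?_) i
      · simp [s, hE0]
      · simp [s, hE, hR]
    · intro k hk
      rw [Finsupp.add_apply, Finsupp.single_eq_of_ne (a := 0) (a' := k) (fun h => hk ⟨0, h.symm⟩),
        zero_add]
      exact hE' k fun ⟨i, hi⟩ => hk ⟨i.succ, hi⟩
    · intro i
      simp [hE]
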